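/- **Setting.** Let $M,N\ge 0$ be integers, $k=(k_1,\dots,k_M)$ real quasi-momenta and $\theta=\{\theta_{j_2j_1}\}_{1\le j_1<j_2\le M}$ real scattering angles. For symbols $a\neq b$ put $f(a,b)=1$ if $a<b$ and $f(a,b)=-e^{i\theta_{ab}}$ if $a>b$. For a finite set $A\subset\mathbb Z$ of sites, with occupation basis $|\sigma\rangle$, $\sigma\in\{0,1\}^A$, the $M$-particle Bethe wavefunction on $A$ is $$|\Phi^{k,\theta}\rangle_A=\sum_{x_1<\dots<x_M,\;x_j\in A}\ \sum_{P\in S_M}\Theta[P]\,e^{i\sum_j k_{P_j}x_j}\,|x_1\cdots x_M\rangle,\qquad \Theta[P]=\prod_{j_1<j_2}f(P_{j_1},P_{j_2}),$$ where $|x_1\cdots x_M\rangle$ is the basis vector with ones exactly at the sites $x_j$. A *choice* is an increasing vector $c=(c_1<\dots<c_m)$ with entries in $\{1,\dots,M\}$ (there are $2^M$ of them), $\mathbf 1=(1,\dots,M)$, and the local Bethe wavefunction $|c\rangle_A$ is the $m$-particle Bethe wavefunction on $A$ with data $(k_{c_j})_j$ and $(\theta_{c_{j_2}c_{j_1}})$.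 For choices let $\Theta[a,b]=\prod_{\alpha\in a}\prod_{\beta\in b}f(\alpha,\beta)$ and $\Theta_q[\nu_1,\dots,\nu_q]=\prod_{i<j}\Theta[\nu_i,\nu_j]$; let $\nu_1\cup\dots\cup\nu_q$ be the sorted concatenation, repeated entries being kept (so it is a choice only if the $\nu_i$ are disjoint). Define the tensors $$\mathbb T^{\mu}_{\nu_1\cdots\nu_q}=\delta_{\nu_1\cup\cdots\cup\nu_q,\ \mu}\ \Theta_q[\nu_1,\dots,\nu_q],\qquad \mathbb S[i]^{a}_{\sigma}=\langle\sigma|a\rangle_{A_i}.$$ A left-right $L$-partition of the lattice $\{1,\dots,N\}$ is a decomposition into parts $A_1,\dots,A_L$ such that every site of $A_i$ is smaller than every site of $A_j$ for $i<j$. **Theorem (general planar TTN representation).** Let a planar tree with $K$ nodes, one root edge and $L$ leaf edges be given, its edges directed from the root to the leaves and its leaves numbered from left to right, and let $A_1,\dots,A_L$ be a left-right $L$-partition of $\{1,\dots,N\}$. Put on each of the $K$ nodes, say with incoming edge $e$ and outgoing edges $e_1,\dots,e_q$ from left to right, the tensor $\mathbb T^{\mu_e}_{\mu_{e_1}\cdots\mu_{e_q}}$;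 put on the $i$-th leaf, with edge $\ell_i$, the tensor $\mathbb S[i]^{\mu_{\ell_i}}_{\sigma_{A_i}}$; and set the index of the root edge to $\mathbf 1$. Then this tree tensor network, made of $K$ tensors $\mathbb T$ and $L$ tensors $\mathbb S[i]$, represents the Bethe wavefunction on $\{1,\dots,N\}$ exactly: for every $\sigma\in\{0,1\}^N$, $$\langle\sigma|\Phi^{k,\theta}\rangle_{\{1,\dots,N\}}=\sum_{\substack{(\mu_e)_e\\ \mu_{\rm root}=\mathbf 1}}\ \prod_{\text{nodes}}\mathbb T^{\mu_e}_{\mu_{e_1}\cdots\mu_{e_q}}\ \prod_{i=1}^{L}\mathbb S[i]^{\mu_{\ell_i}}_{\sigma_{A_i}},$$ where every $\mu_e$ runs over all choices. Its bond dimension is at most $2^M$, independently of $N$. This contains the following special cases. 1. (Matrix product state.) For every left-right $L$-partition, with $\mathbb R[i]^{\mu,\mu'}_{\sigma}=\sum_a\mathbb T^{\mu}_{a,\mu'}\,\mathbb S[i]^a_{\sigma}$ regarded as $2^M\times 2^M$ matrices, $\langle\sigma|\Phi^{k,\theta}\rangle=\big(\mathbb R[1]_{\sigma_{A_1}}\cdots\mathbb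 R[L]_{\sigma_{A_L}}\big)^{\mathbf 1,\emptyset}$; for $L\ge1$ this is the value of the network of the chain with $L$ nodes and $L$ leaves, in which every node but the last has a leaf and the rest of the chain as its two children, and the last node has one leaf as its only child. 2. (Regular binary tree.) For $L=2^Z$ the regular binary tree has $L$ leaves and $L-1$ nodes, and its network, made of $L-1$ tensors $\mathbb T$ and $L$ tensors $\mathbb S[i]$, represents the Bethe wavefunction exactly with bond dimension at most $2^M$. -/

import Mathlib

/-! ## Bethe wavefunctions

A lattice is a finite set `A` of sites, each site being an integer `x` (its position).
An occupation configuration of `A` is a bit string `σ : A → Fin 2`, and a wavefunction on `A` is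
the family of its amplitudes in the occupation basis, that is, a function `(A → Fin 2) → ℂ`. -/

/-- Occupation configurations (bit strings) of the sites of `A`. -/
abbrev Occupation (A : Finset ℕ) : Type := A → Fin 2

/-- The vector `|σ⟩` of the occupation basis. -/
def ket {A : Finset ℕ} (σ : Occupation A) : Occupation A → ℂ := Pi.single σ 1

/-- The bit string of `m` particles located at `x 0, …, x (m-1)`. -/
def occupationOf {A : Finset ℕ} {m : ℕ} (x : Fin m → A) : Occupation A :=
  fun a => if ∃ j, x j = a then 1 else 0

open Classical in
/-- The domain of ordered position vectors `x₁ < x₂ < ⋯ < x_m` in `A`. -/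
noncomputable def positions (A : Finset ℕ) (m : ℕ) : Finset (Fin m → A) :=
  Finset.univ.filter StrictMono

/-- The scattering phase of an ordered pair of symbols `(a, b)`: it is `-exp (i θ_{a b})` if
`a > b` and `1` otherwise. Only the angles `θ a b` with `b < a` are ever used. -/
noncomputable def scatteringPhase {m : ℕ} (θ : Fin m → Fin m → ℝ) (a b : Fin m) : ℂ :=
  if b < a then -Complex.exp (Complex.I * (θ a b : ℂ)) else 1

/-- The scattering amplitude `Θ[P]` of a permutation: the product over all pairs `j₁ < j₂`
of the phase of the pair `(P_{j₁}, P_{j₂})`. -/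
noncomputable def permAmplitude {m : ℕ} (θ : Fin m → Fin m → ℝ) (P : Equiv.Perm (Fin m)) : ℂ :=
  ∏ j₁, ∏ j₂ ∈ Finset.Ioi j₁, scatteringPhase θ (P j₁) (P j₂)

/-- The `m`-particle Bethe wavefunction on the lattice `A` with quasi-momenta `k` and
scattering angles `θ` (not normalized):
`∑_{x₁ < ⋯ < x_m in A} ∑_P Θ[P] exp (i ∑_j k_{P_j} x_j) |x₁, …, x_m⟩`. -/
noncomputable def betheWavefunction (A : Finset ℕ) {m : ℕ} (k : Fin m → ℝ)
    (θ : Fin m → Fin m → ℝ) : Occupation A → ℂ :=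
  ∑ x ∈ positions A m,
    (∑ P : Equiv.Perm (Fin m),
      permAmplitude θ P * Complex.exp (Complex.I * ∑ j, (k (P j) : ℂ) * ((x j : ℕ) : ℂ))) •
      ket (occupationOf x)

/-! ## Choices and the tensors `T` and `S` -/

/-- A choice vector `1 ≤ c₁ < ⋯ < c_m ≤ M`, identified with the set of its components. -/
abbrev Choice (M : ℕ) : Type := Finset (Fin M)

/-- The local Bethe wavefunction `|c⟩` on `A`: the Bethe wavefunction with the reduced data
`(k_{c₁}, …, k_{c_m})` and `θ_{c_{j₂} c_{j₁}}`. -/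
noncomputable def localBethe {M : ℕ} (k : Fin M → ℝ) (θ : Fin M → Fin M → ℝ) (A : Finset ℕ)
    (c : Choice M) : Occupation A → ℂ :=
  betheWavefunction A (fun j => k (c.orderEmbOfFin rfl j))
    (fun j₂ j₁ => θ (c.orderEmbOfFin rfl j₂) (c.orderEmbOfFin rfl j₁))

/-- The bipartite scattering amplitude `Θ[a, b]`. -/
noncomputable def pairAmplitude {M : ℕ} (θ : Fin M → Fin M → ℝ) (a b : Choice M) : ℂ :=
  ∏ α ∈ a, ∏ β ∈ b, scatteringPhase θ α β

/-- The multipartite scattering amplitude `Θ_q[ν₁, …, ν_q] = ∏_{i < j} Θ[ν_i, ν_j]`. -/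
noncomputable def multiAmplitude {M : ℕ} (θ : Fin M → Fin M → ℝ) {q : ℕ}
    (ν : Fin q → Choice M) : ℂ :=
  ∏ i, ∏ j ∈ Finset.Ioi i, pairAmplitude θ (ν i) (ν j)

/-- The union `ν₁ ∪ ⋯ ∪ ν_q` of choices: all their components sorted together, where repeated
components are kept. Such a sorted vector is the same thing as a multiset. -/
def choiceUnion {M q : ℕ} (ν : Fin q → Choice M) : Multiset (Fin M) := ∑ i, (ν i).val

/-- The generalized tensor `T` with one incoming index `μ` and `q` outgoing indices `ν`:
`δ_{ν₁ ∪ ⋯ ∪ ν_q, μ} Θ_q[ν₁, …, ν_q]`. -/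
noncomputable def tensorT {M : ℕ} (θ : Fin M → Fin M → ℝ) {q : ℕ} (μ : Choice M)
    (ν : Fin q → Choice M) : ℂ :=
  (if choiceUnion ν = μ.val then 1 else 0) * multiAmplitude θ ν

/-- The change-of-basis tensor `S` of a part `A`: `S^a_σ = ⟨σ|a⟩`. -/
noncomputable def tensorS {M : ℕ} (k : Fin M → ℝ) (θ : Fin M → Fin M → ℝ) (A : Finset ℕ)
    (a : Choice M) (σ : Occupation A) : ℂ :=
  localBethe k θ A a σ

/-! ## Left-right partitions -/

/-- A left-right partition of the lattice `{1, …, N}` into `L` parts: part `i` is to the left of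
part `j` whenever `i < j` (so the parts are disjoint and contiguous). -/
structure LeftRightPartition (N L : ℕ) where
  part : Fin L → Finset ℕ
  cover : Finset.univ.biUnion part = Finset.Icc 1 N
  ordered : ∀ i j, i < j → ∀ x ∈ part i, ∀ y ∈ part j, x < y

/-- The bit string `σ_{A_i}` of part `i`: the restriction of the bit string `σ` of the lattice. -/
def LeftRightPartition.restrict {N L : ℕ} (A : LeftRightPartition N L)
    (σ : Occupation (Finset.Icc 1 N)) (i : Fin L) : Occupation (A.part i) :=
  fun x => σ ⟨x.1, A.cover ▸ Finset.mem_biUnion.2 ⟨i, Finset.mem_univ i, x.2⟩⟩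

/-! ## Planar trees -/

/-- Planar (that is, ordered) trees hanging from a root edge. The root edge ends either at a leaf
(it is then a leaf edge too) or at a node with `q` outgoing edges, ordered from left to right; the
`i`-th of them is the root edge of the planar tree `child i`. -/
inductive PlanarTree : Type
  | leaf : PlanarTree
  | node (q : ℕ) (child : Fin q → PlanarTree) : PlanarTree

namespace PlanarTree

/-- The nodes of a tree (leaves are not nodes). -/
def Node : PlanarTree → Type
  | leaf => Empty
  | node q c => Option ((i : Fin q) × Node (c i))

/-- The edges of a tree, including the root edge (`()` or `none`) and the leaf edges. -/
def Edge : PlanarTree → Type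
  | leaf => Unit
  | node q c => Option ((i : Fin q) × Edge (c i))

instance instFintypeNode : (t : PlanarTree) → Fintype t.Node
  | leaf => inferInstanceAs (Fintype Empty)
  | node q c =>
    haveI : ∀ i, Fintype (c i).Node := fun i => instFintypeNode (c i)
    inferInstanceAs (Fintype (Option ((i : Fin q) × Node (c i))))

instance instFintypeEdge : (t : PlanarTree) → Fintype t.Edge
  | leaf => inferInstanceAs (Fintype Unit)
  | node q c =>
    haveI : ∀ i, Fintype (c i).Edge := fun i => instFintypeEdge (c i)
    inferInstanceAs (Fintype (Option ((i : Fin q) × Edge (c i))))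

/-- The number of nodes. -/
def numNodes : PlanarTree → ℕ
  | leaf => 0
  | node _ c => 1 + ∑ i, numNodes (c i)

/-- The number of leaves. -/
def numLeaves : PlanarTree → ℕ
  | leaf => 1
  | node _ c => ∑ i, numLeaves (c i)

/-- The root edge. -/
def rootEdge : (t : PlanarTree) → t.Edge
  | leaf => ()
  | node _ _ => none

/-- The edge that ends at the `i`-th leaf, where the leaves are numbered from left to right:
first all leaves of the first child, then all leaves of the second child, and so on. -/
def leafEdge : (t : PlanarTree) → Fin t.numLeaves → t.Edge
  | leaf, _ => ()
  | node _ c, ℓ =>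
    let p := (finSigmaFinEquiv (n := fun i => numLeaves (c i))).symm ℓ
    some ⟨p.1, leafEdge (c p.1) p.2⟩

/-- The incoming edge of a node, for the flow from the root to the leaves. -/
def inEdge : (t : PlanarTree) → t.Node → t.Edge
  | leaf, v => v.elim
  | node _ _, none => none
  | node _ c, some ⟨i, v⟩ => some ⟨i, inEdge (c i) v⟩

/-- The number of outgoing edges of a node. -/
def arity : (t : PlanarTree) → t.Node → ℕ
  | leaf, v => v.elim
  | node q _, none => q
  | node _ c, some ⟨i, v⟩ => arity (c i) v

/-- The outgoing edges of a node, from left to right. -/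
def outEdge : (t : PlanarTree) → (v : t.Node) → Fin (t.arity v) → t.Edge
  | leaf, v, _ => v.elim
  | node _ c, none, j => some ⟨j, rootEdge (c j)⟩
  | node _ c, some ⟨i, v⟩, j => some ⟨i, outEdge (c i) v j⟩

/-- The chain with `n + 1` nodes: every node but the last has a leaf as its first child and the
rest of the chain as its second child; the last node has a single child, a leaf. -/
def chain : ℕ → PlanarTree
  | 0 => node 1 (fun _ => leaf)
  | n + 1 => node 2 ![leaf, chain n]

/-- The regular binary tree with `Z` layers of nodes. -/
def binary : ℕ → PlanarTree
  | 0 => leaf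
  | Z + 1 => node 2 (fun _ => binary Z)

end PlanarTree

/-! ## Planar tree tensor networks -/

/-- A tree tensor network on the planar tree `t`, with physical index set `phys i` at leaf `i`.
Every edge carries a finite index set, every node a tensor with the indices of its incoming and
outgoing edges, and every leaf a tensor with the index of its edge and the physical index.
The index of the root edge is set to a fixed value. -/
structure PlanarTTN (t : PlanarTree) (phys : Fin t.numLeaves → Type) where
  Index : t.Edge → Type
  fintypeIndex : ∀ e, Fintype (Index e)
  nodeTensor : ∀ v : t.Node,
    Index (t.inEdge v) → (∀ j : Fin (t.arity v), Index (t.outEdge v j)) → ℂ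
  leafTensor : ∀ i : Fin t.numLeaves, Index (t.leafEdge i) → phys i → ℂ
  rootIndex : Index t.rootEdge

namespace PlanarTTN

variable {t : PlanarTree} {phys : Fin t.numLeaves → Type}

instance (𝒩 : PlanarTTN t phys) (e : t.Edge) : Fintype (𝒩.Index e) := 𝒩.fintypeIndex e

open Classical in
/-- The contraction of the network: the sum, over all values of the indices of all edges
(the root index being fixed), of the product of all tensors. -/
noncomputable def contraction (𝒩 : PlanarTTN t phys) (σ : ∀ i, phys i) : ℂ :=
  ∑ μ : (∀ e : t.Edge, 𝒩.Index e) with μ t.rootEdge = 𝒩.rootIndex,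
    (∏ v : t.Node, 𝒩.nodeTensor v (μ (t.inEdge v)) (fun j => μ (t.outEdge v j))) *
      ∏ i, 𝒩.leafTensor i (μ (t.leafEdge i)) (σ i)

/-- The bond dimension: the largest size of an index set of an edge. -/
def bondDim (𝒩 : PlanarTTN t phys) : ℕ :=
  Finset.univ.sup fun e : t.Edge => Fintype.card (𝒩.Index e)

/-- The number of node tensors of the network. -/
def numNodeTensors (_ : PlanarTTN t phys) : ℕ := Fintype.card t.Node

/-- The number of leaf tensors of the network. -/
def numLeafTensors (_ : PlanarTTN t phys) : ℕ := Fintype.card (Fin t.numLeaves)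

end PlanarTTN

/-- The tree tensor network with a tensor `T` at every node, the tensor `S` of part `i` at the
`i`-th leaf, and the root index set to the choice `(1, …, M)` of all symbols. -/
noncomputable def betheTTN {M N : ℕ} (k : Fin M → ℝ) (θ : Fin M → Fin M → ℝ) (t : PlanarTree)
    (A : LeftRightPartition N t.numLeaves) :
    PlanarTTN t (fun i => Occupation (A.part i)) where
  Index _ := Choice M
  fintypeIndex _ := inferInstance
  nodeTensor _ μ ν := tensorT θ μ ν
  leafTensor i a σ := tensorS k θ (A.part i) a σ
  rootIndex := (Finset.univ : Finset (Fin M))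

/-- The matrix product state tensor `R`, for a fixed value `σ` of the physical index of the part
`A`: `R_σ^{μ, μ'} = ∑_a T^μ_{a, μ'} S^a_σ`. -/
noncomputable def tensorR {M : ℕ} (k : Fin M → ℝ) (θ : Fin M → Fin M → ℝ) (A : Finset ℕ)
    (σ : Occupation A) : Matrix (Choice M) (Choice M) ℂ :=
  Matrix.of fun μ μ' => ∑ a, tensorT θ μ ![a, μ'] * tensorS k θ A a σ

/-!
Functions `F` of a choice form an algebra under the twisted product
`(F * G) μ = ∑ T^μ_{a, b} F a G b`, whose unit is the indicator of the empty choice. The binary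
tensors satisfy an associativity relation (`tensorT_assoc`), because the amplitude `Θ[a, b]` is
multiplicative in each argument for disjoint unions. Hence the matrices `leftMul θ F` of left
multiplication obey `leftMul (F * G) = leftMul F * leftMul G`. The matrix product state tensor
`R` is the left multiplication by `S`, and the column of a product of left multiplications at the
empty choice recovers the twisted product itself.

A tensor `T` with `q` outgoing edges is an iterated contraction of binary tensors
(`tensorT_succ`), so it computes the ordered product of the `q` vectors on its outgoing edges
(`sum_tensorT_mul_prod`). By induction on the tree, every planar network equals the ordered
product of the vectors at its leaves (`treeContraction_eq_prod`), whatever the shape of the tree.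

It remains to see that the Bethe wavefunction is multiplicative as well. The amplitude of a bit
string with occupied sites `x₁ < ⋯ < x_m` is the ordered product of the vectors `siteVector k x_j`
that carry the plane waves of one particle: expanding this product at a choice with `m` entries,
the delta in `T` leaves one term for each permutation of the entries, with amplitude `Θ[P]`
(`prod_siteVector`, `betheWavefunction_eq_prod`). The occupied sites of the lattice are those of
the parts of a left-right partition, one part after the other, so the product over the lattice is
the product of the products over the parts (`betheWavefunction_eq_prod_tensorR`).
-/

open scoped Matrix

/-! ### Scattering amplitudes and the tensor `T` -/

theorem choiceUnion_zero {M : ℕ} (ν : Fin 0 → Choice M) : choiceUnion ν = 0 := by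
  simp [choiceUnion]

theorem choiceUnion_succ {M q : ℕ} (ν : Fin (q + 1) → Choice M) :
    choiceUnion ν = (ν 0).val + choiceUnion (fun i => ν i.succ) := by
  simp [choiceUnion, Fin.sum_univ_succ]

theorem choiceUnion_pair {M : ℕ} (a b : Choice M) : choiceUnion ![a, b] = a.val + b.val := by
  simp [choiceUnion]

/-- The bipartite amplitude as a product over the multiset of the entries of its second argument,
which makes it multiplicative for unions with repetitions kept. -/
theorem pairAmplitude_eq_multiset_prod {M : ℕ} (θ : Fin M → Fin M → ℝ) (a b : Choice M) :
    pairAmplitude θ a b = (b.val.map fun β => ∏ α ∈ a, scatteringPhase θ α β).prod := by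
  rw [pairAmplitude, Finset.prod_comm]
  rfl

theorem pairAmplitude_of_val_eq_choiceUnion {M q : ℕ} (θ : Fin M → Fin M → ℝ) (a ρ : Choice M)
    (ν : Fin q → Choice M) (h : choiceUnion ν = ρ.val) :
    pairAmplitude θ a ρ = ∏ i, pairAmplitude θ a (ν i) := by
  simp only [pairAmplitude_eq_multiset_prod, ← h, choiceUnion]
  rw [← Multiset.coe_mapAddMonoidHom, map_sum, Multiset.prod_sum]

theorem pairAmplitude_add_left {M : ℕ} (θ : Fin M → Fin M → ℝ) (a b c ρ : Choice M)
    (h : a.val + b.val = ρ.val) :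
    pairAmplitude θ ρ c = pairAmplitude θ a c * pairAmplitude θ b c := by
  simp only [pairAmplitude, Finset.prod_eq_multiset_prod, ← h, Multiset.map_add,
    Multiset.prod_add]

theorem multiAmplitude_succ {M q : ℕ} (θ : Fin M → Fin M → ℝ) (ν : Fin (q + 1) → Choice M) :
    multiAmplitude θ ν =
      (∏ i : Fin q, pairAmplitude θ (ν 0) (ν i.succ)) *
        multiAmplitude θ (fun i => ν i.succ) := by
  simp [multiAmplitude, Fin.prod_univ_succ, Fin.prod_Ioi_succ]

theorem multiAmplitude_pair {M : ℕ} (θ : Fin M → Fin M → ℝ) (a b : Choice M) :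
    multiAmplitude θ ![a, b] = pairAmplitude θ a b := by
  simp only [multiAmplitude_succ]
  simp [multiAmplitude]

theorem tensorT_pair {M : ℕ} (θ : Fin M → Fin M → ℝ) (μ a b : Choice M) :
    tensorT θ μ ![a, b] = if a.val + b.val = μ.val then pairAmplitude θ a b else 0 := by
  simp [tensorT, choiceUnion_pair, multiAmplitude_pair]

/-- If `U` is the sorted concatenation of some choices, a sum over the choices `ρ` with `ρ = U`
has at most one term, which is present exactly if `U` has no repetitions. -/
theorem sum_choice_ite {M : ℕ} (U : Multiset (Fin M)) (F : Choice M → ℂ) :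
    (∑ ρ : Choice M, if U = ρ.val then F ρ else 0) =
      if h : U.Nodup then F ⟨U, h⟩ else 0 := by
  split_ifs with h
  · rw [Finset.sum_eq_single ⟨U, h⟩]
    · simp
    · intro ρ _ hρ
      rw [if_neg]
      rintro rfl
      exact hρ rfl
    · simp
  · refine Finset.sum_eq_zero fun ρ _ => if_neg ?_
    rintro rfl
    exact h ρ.nodup

/-- A tensor with `q + 1` outgoing edges is the contraction of a binary tensor, which splits off
the first outgoing edge, with a tensor with `q` outgoing edges. -/
theorem tensorT_succ {M q : ℕ} (θ : Fin M → Fin M → ℝ) (μ : Choice M)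
    (ν : Fin (q + 1) → Choice M) :
    tensorT θ μ ν = ∑ ρ, tensorT θ μ ![ν 0, ρ] * tensorT θ ρ (fun i => ν i.succ) := by
  -- If the entries of `ν 1, …, ν q` have repetitions, then both sides vanish.
  have h1 : ∀ ρ, tensorT θ μ ![ν 0, ρ] * tensorT θ ρ (fun i => ν i.succ) =
      if choiceUnion (fun i => ν i.succ) = ρ.val then
        tensorT θ μ ![ν 0, ρ] * multiAmplitude θ (fun i => ν i.succ) else 0 := by
    intro ρ
    simp [tensorT]
  simp only [h1, sum_choice_ite]
  split_ifs with h
  · rw [tensorT_pair, tensorT, choiceUnion_succ, multiAmplitude_succ,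
      pairAmplitude_of_val_eq_choiceUnion θ (ν 0) ⟨_, h⟩ _ rfl]
    simp [ite_mul]
  · rw [tensorT, if_neg, zero_mul]
    intro h'
    rw [choiceUnion_succ] at h'
    exact h (Multiset.nodup_add.1 (h' ▸ μ.nodup)).2.1

/-- The two ways of building a tensor with three outgoing edges from two binary tensors agree. -/
theorem tensorT_assoc {M : ℕ} (θ : Fin M → Fin M → ℝ) (μ a b c : Choice M) :
    ∑ ρ, tensorT θ μ ![ρ, c] * tensorT θ ρ ![a, b] =
      ∑ ρ, tensorT θ μ ![a, ρ] * tensorT θ ρ ![b, c] := by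
  have hr := tensorT_succ θ μ ![a, b, c]
  have e : (fun i : Fin 2 => ![a, b, c] i.succ) = ![b, c] := by
    ext i; fin_cases i <;> rfl
  rw [e] at hr
  change _ = ∑ ρ, tensorT θ μ ![a, ρ] * tensorT θ ρ ![b, c] at hr
  rw [← hr]
  have h1 : ∀ ρ, tensorT θ μ ![ρ, c] * tensorT θ ρ ![a, b] =
      if a.val + b.val = ρ.val then tensorT θ μ ![ρ, c] * pairAmplitude θ a b else 0 := by
    intro ρ
    simp [tensorT_pair θ ρ a b]
  simp only [h1, sum_choice_ite]
  rw [tensorT, choiceUnion_succ, multiAmplitude_succ, e, multiAmplitude_pair]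
  change _ = (if a.val + choiceUnion ![b, c] = μ.val then (1 : ℂ) else 0) * _
  rw [choiceUnion_pair, ← add_assoc]
  split_ifs with h h' h'
  · rw [tensorT_pair, if_pos h', pairAmplitude_add_left θ a b c ⟨_, h⟩ rfl]
    simp [Fin.prod_univ_two]
    ring
  · rw [tensorT_pair, if_neg h']
    simp
  · exact absurd (Multiset.nodup_add.1 (h' ▸ μ.nodup)).1 h
  · simp

/-! ### The twisted product of functions of a choice -/

/-- The matrix of left multiplication by `F` in the algebra of functions of a choice, where the
product of `F` and `G` is `μ ↦ ∑ T^μ_{a, b} F a G b`. -/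
noncomputable def leftMul {M : ℕ} (θ : Fin M → Fin M → ℝ) (F : Choice M → ℂ) :
    Matrix (Choice M) (Choice M) ℂ :=
  Matrix.of fun μ μ' => ∑ a, tensorT θ μ ![a, μ'] * F a

theorem leftMul_apply {M : ℕ} (θ : Fin M → Fin M → ℝ) (F : Choice M → ℂ) (μ μ' : Choice M) :
    leftMul θ F μ μ' = ∑ a, tensorT θ μ ![a, μ'] * F a :=
  rfl

theorem leftMul_apply_empty {M : ℕ} (θ : Fin M → Fin M → ℝ) (F : Choice M → ℂ) (μ : Choice M) :
    leftMul θ F μ ∅ = F μ := by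
  simp [leftMul_apply, tensorT_pair, pairAmplitude]

/-- Left multiplication is multiplicative: this is associativity of the twisted product. -/
theorem leftMul_mulVec {M : ℕ} (θ : Fin M → Fin M → ℝ) (F G : Choice M → ℂ) :
    leftMul θ (leftMul θ F *ᵥ G) = leftMul θ F * leftMul θ G := by
  ext μ c
  have h1 : leftMul θ (leftMul θ F *ᵥ G) μ c =
      ∑ a, ∑ b, (∑ ρ, tensorT θ μ ![ρ, c] * tensorT θ ρ ![a, b]) * (F a * G b) := by
    simp only [leftMul, Matrix.of_apply, Matrix.mulVec, dotProduct, Finset.mul_sum, Finset.sum_mul]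
    rw [Finset.sum_comm, Finset.sum_congr rfl fun b _ => Finset.sum_comm, Finset.sum_comm]
    refine Finset.sum_congr rfl fun a _ => Finset.sum_congr rfl fun b _ =>
      Finset.sum_congr rfl fun ρ _ => ?_
    ring
  have h2 : (leftMul θ F * leftMul θ G) μ c =
      ∑ a, ∑ b, (∑ ρ, tensorT θ μ ![a, ρ] * tensorT θ ρ ![b, c]) * (F a * G b) := by
    simp only [leftMul, Matrix.of_apply, Matrix.mul_apply, Finset.mul_sum, Finset.sum_mul]
    rw [Finset.sum_congr rfl fun ρ _ => Finset.sum_comm, Finset.sum_comm]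
    refine Finset.sum_congr rfl fun a _ => ?_
    rw [Finset.sum_comm]
    refine Finset.sum_congr rfl fun b _ => Finset.sum_congr rfl fun ρ _ => ?_
    ring
  rw [h1, h2]
  simp only [tensorT_assoc]

theorem leftMul_single_empty {M : ℕ} (θ : Fin M → Fin M → ℝ) :
    leftMul θ (Pi.single ∅ 1) = 1 := by
  ext μ μ'
  simp only [leftMul, Matrix.of_apply, Pi.single_apply, mul_ite, mul_one, mul_zero,
    Finset.sum_ite_eq', Finset.mem_univ, if_true, tensorT_pair, Matrix.one_apply]
  simp [pairAmplitude, eq_comm]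

/-- A product of left multiplications is the left multiplication by its column at `∅`. -/
theorem leftMul_prod_col {M : ℕ} (θ : Fin M → Fin M → ℝ) (l : List (Choice M → ℂ)) :
    leftMul θ (fun μ => (l.map (leftMul θ)).prod μ ∅) = (l.map (leftMul θ)).prod := by
  induction l with
  | nil =>
    rw [List.map_nil, List.prod_nil, ← leftMul_single_empty θ]
    congr 1
    ext μ
    rw [leftMul_single_empty, Matrix.one_apply, Pi.single_apply]
  | cons F l ih =>
    rw [List.map_cons, List.prod_cons]
    conv_rhs => rw [← ih, ← leftMul_mulVec]
    rfl

/-- The contraction of a tensor `T` with vectors on its outgoing edges is the ordered product of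
these vectors. -/
theorem sum_tensorT_mul_prod {M : ℕ} (θ : Fin M → Fin M → ℝ) {q : ℕ}
    (F : Fin q → Choice M → ℂ) (μ : Choice M) :
    ∑ ν : Fin q → Choice M, tensorT θ μ ν * ∏ i, F i (ν i) =
      (List.ofFn fun i => leftMul θ (F i)).prod μ ∅ := by
  induction q generalizing μ with
  | zero =>
    simp [tensorT, choiceUnion_zero, multiAmplitude, Matrix.one_apply, eq_comm]
  | succ q ih =>
    have hcons : ∑ ν : Fin (q + 1) → Choice M, tensorT θ μ ν * ∏ i, F i (ν i) =
        ∑ a, ∑ ν : Fin q → Choice M, (∑ ρ, tensorT θ μ ![a, ρ] * tensorT θ ρ ν) *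
          (F 0 a * ∏ i : Fin q, F i.succ (ν i)) := by
      rw [← (Fin.consEquiv (fun _ => Choice M)).sum_comp, Fintype.sum_prod_type]
      refine Finset.sum_congr rfl fun a _ => Finset.sum_congr rfl fun ν _ => ?_
      rw [tensorT_succ, Fin.prod_univ_succ]
      rfl
    rw [hcons, List.ofFn_succ, List.prod_cons, Matrix.mul_apply]
    simp only [← ih, leftMul_apply, Finset.sum_mul, Finset.mul_sum]
    rw [Finset.sum_congr rfl fun a _ => Finset.sum_comm, Finset.sum_comm]
    refine Finset.sum_congr rfl fun ρ _ => ?_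
    rw [Finset.sum_comm]
    refine Finset.sum_congr rfl fun ν _ => Finset.sum_congr rfl fun a _ => ?_
    ring

/-! ### Contraction of planar trees -/

/-- The ordered product of a family indexed lexicographically by pairs is the ordered product of
the ordered products of its rows. -/
theorem prod_ofFn_finSigmaFinEquiv {R : Type*} [Monoid R] {q : ℕ} (n : Fin q → ℕ)
    (g : ((i : Fin q) × Fin (n i)) → R) :
    (List.ofFn fun ℓ => g (finSigmaFinEquiv.symm ℓ)).prod =
      (List.ofFn fun i => (List.ofFn fun j => g ⟨i, j⟩).prod).prod := by
  induction q with
  | zero =>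
    rw [List.ofFn_zero, List.prod_nil]
    exact congrArg List.prod (List.ofFn_eq_nil_iff.2 (Fin.sum_univ_zero n))
  | succ q ih =>
    have hsum := Fin.sum_univ_castSucc n
    have happ : (fun ℓ => g (finSigmaFinEquiv.symm ℓ)) =
        Fin.append (fun ℓ => g ⟨(finSigmaFinEquiv.symm ℓ).1.castSucc,
            (finSigmaFinEquiv (n := fun i : Fin q => n i.castSucc).symm ℓ).2⟩)
          (fun j => g ⟨Fin.last q, j⟩) ∘ Fin.cast hsum := by
      funext ℓ
      obtain ⟨p, rfl⟩ := (finCongr hsum).symm.surjective ℓ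
      refine Fin.addCases (fun p => ?_) (fun j => ?_) p
      · obtain ⟨⟨i, j⟩, rfl⟩ := finSigmaFinEquiv.surjective p
        have : (finCongr hsum).symm (Fin.castAdd (n (Fin.last q)) (finSigmaFinEquiv ⟨i, j⟩)) =
            finSigmaFinEquiv ⟨i.castSucc, j⟩ := by
          ext
          simp [finSigmaFinEquiv_apply]
        have hcast : Fin.cast hsum (finSigmaFinEquiv ⟨i.castSucc, j⟩) =
            Fin.castAdd (n (Fin.last q)) (finSigmaFinEquiv ⟨i, j⟩) := by
          rw [← this]
          rfl
        rw [this, Function.comp_apply, hcast, Fin.append_left, Equiv.symm_apply_apply]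
        exact (congrArg (fun p : (i : Fin q) × Fin (n i.castSucc) => g ⟨p.1.castSucc, p.2⟩)
          (finSigmaFinEquiv.symm_apply_apply ⟨i, j⟩)).symm
      · have : (finCongr hsum).symm (Fin.natAdd _ j) = finSigmaFinEquiv ⟨Fin.last q, j⟩ := by
          ext
          simp [finSigmaFinEquiv_apply]
          rfl
        have hcast : Fin.cast hsum (finSigmaFinEquiv ⟨Fin.last q, j⟩) = Fin.natAdd _ j := by
          rw [← this]
          rfl
        rw [this, Function.comp_apply, hcast]
        simp
    rw [List.ofFn_succ_last, List.prod_append, List.prod_singleton, ← ih (fun i => n i.castSucc)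
      (fun p => g ⟨p.1.castSucc, p.2⟩), ← List.prod_append, ← List.ofFn_fin_append, happ]
    congr 1
    exact (List.ofFn_congr hsum _)

namespace PlanarTree

theorem card_node (t : PlanarTree) : Fintype.card t.Node = t.numNodes := by
  induction t with
  | leaf => rfl
  | node q c ih =>
    have h : Fintype.card (node q c).Node = Fintype.card (Option ((i : Fin q) × (c i).Node)) :=
      Fintype.card_congr (Equiv.refl _)
    rw [h, Fintype.card_option, Fintype.card_sigma, numNodes, add_comm]
    simp only [ih]

/-- An assignment of indices to the edges of a tree consists of an index of its root edge and
assignments for the subtrees below its root node. -/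
def edgeAssignmentEquiv (X : Type) (q : ℕ) (c : Fin q → PlanarTree) :
    ((node q c).Edge → X) ≃ X × ((i : Fin q) → (c i).Edge → X) where
  toFun μ := (μ none, fun i e => μ (some ⟨i, e⟩))
  invFun p e := match e with
    | none => p.1
    | some ⟨i, e⟩ => p.2 i e
  left_inv μ := by
    funext e
    rcases e with _ | ⟨i, e⟩ <;> rfl
  right_inv p := rfl

theorem leafEdge_node (q : ℕ) (c : Fin q → PlanarTree) (i : Fin q) (j : Fin (c i).numLeaves) :
    (node q c).leafEdge (finSigmaFinEquiv (n := fun i => (c i).numLeaves) ⟨i, j⟩) =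
      some ⟨i, (c i).leafEdge j⟩ := by
  have h : ∀ ℓ : Fin (∑ i, (c i).numLeaves), (node q c).leafEdge ℓ =
      (fun p : (i : Fin q) × Fin (c i).numLeaves =>
        (some ⟨p.1, (c p.1).leafEdge p.2⟩ : Option ((i : Fin q) × (c i).Edge)))
        (finSigmaFinEquiv.symm ℓ) := fun _ => rfl
  rw [h]
  rw [finSigmaFinEquiv.symm_apply_apply]

end PlanarTree

open Classical in
/-- The contraction of the network with a tensor `T` at every node of `t`, the vectors `G` at its
leaves, and the index `μ₀` at its root edge. -/
noncomputable def treeContraction {M : ℕ} (θ : Fin M → Fin M → ℝ) (t : PlanarTree)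
    (G : Fin t.numLeaves → Choice M → ℂ) (μ₀ : Choice M) : ℂ :=
  ∑ μ : t.Edge → Choice M with μ t.rootEdge = μ₀,
    (∏ v : t.Node, tensorT θ (μ (t.inEdge v)) (fun j => μ (t.outEdge v j))) *
      ∏ i, G i (μ (t.leafEdge i))

/-- The two sums differ only in the decision procedure that selects the assignments with the
prescribed root index. -/
theorem contraction_betheTTN {M N : ℕ} (k : Fin M → ℝ) (θ : Fin M → Fin M → ℝ) (t : PlanarTree)
    (A : LeftRightPartition N t.numLeaves) (σ : ∀ i, Occupation (A.part i)) :
    (betheTTN k θ t A).contraction σ =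
      treeContraction θ t (fun i a => tensorS k θ (A.part i) a (σ i)) Finset.univ := by
  classical
  have h : ∀ (p : (t.Edge → Choice M) → Prop) (i₁ i₂ : DecidablePred p)
      (F : (t.Edge → Choice M) → ℂ),
      ∑ μ ∈ @Finset.filter _ p i₁ Finset.univ, F μ =
        ∑ μ ∈ @Finset.filter _ p i₂ Finset.univ, F μ := by
    intro p i₁ i₂ F
    rw [Subsingleton.elim i₁ i₂]
  exact h _ _ _ _

theorem treeContraction_leaf {M : ℕ} (θ : Fin M → Fin M → ℝ)
    (G : Fin PlanarTree.leaf.numLeaves → Choice M → ℂ) (μ₀ : Choice M) :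
    treeContraction θ PlanarTree.leaf G μ₀ = G (0 : Fin 1) μ₀ := by
  classical
  unfold treeContraction
  rw [Finset.sum_eq_single (fun _ => μ₀)]
  · have h : ∀ f : PlanarTree.leaf.Node → ℂ, ∏ v, f v = 1 := fun f =>
      Fintype.prod_empty (ι := Empty) f
    rw [h, one_mul]
    exact Fin.prod_univ_one _
  · intro μ hμ hne
    exact (hne (funext fun _ => (Finset.mem_filter.1 hμ).2)).elim
  · intro h
    exact (h (by simp)).elim

open PlanarTree in
/-- The tensor network of a tree is the contraction of the tensor at its root node with the
networks of the subtrees below it. -/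
theorem treeContraction_node {M : ℕ} (θ : Fin M → Fin M → ℝ) (q : ℕ) (c : Fin q → PlanarTree)
    (G : Fin (PlanarTree.node q c).numLeaves → Choice M → ℂ) (μ₀ : Choice M) :
    treeContraction θ (PlanarTree.node q c) G μ₀ =
      ∑ ν : Fin q → Choice M, tensorT θ μ₀ ν *
        ∏ i, treeContraction θ (c i)
          (fun j => G (finSigmaFinEquiv (n := fun i => (c i).numLeaves) ⟨i, j⟩)) (ν i) := by
  classical
  -- Nodes, leaves and edge assignments split into the root part and one part for each subtree.
  have hnode : ∀ f : (node q c).Node → ℂ,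
      ∏ v, f v = f none * ∏ i, ∏ v : (c i).Node, f (some ⟨i, v⟩) := by
    intro f
    have h : ∏ v, f v = ∏ v : Option ((i : Fin q) × (c i).Node), f v :=
      Fintype.prod_equiv (Equiv.refl _) _ _ fun _ => rfl
    refine h.trans ((Fintype.prod_option (α := (i : Fin q) × (c i).Node) f).trans ?_)
    congr 1
    exact Fintype.prod_sigma _
  have hleaf : ∀ f : Fin (node q c).numLeaves → ℂ,
      ∏ ℓ, f ℓ = ∏ i, ∏ j, f (finSigmaFinEquiv (n := fun i => (c i).numLeaves) ⟨i, j⟩) := by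
    intro f
    rw [← Fintype.prod_sigma']
    exact (Equiv.prod_comp (finSigmaFinEquiv (n := fun i => (c i).numLeaves)) f).symm
  have hedge : ∀ F : ((node q c).Edge → Choice M) → ℂ,
      ∑ μ with μ (node q c).rootEdge = μ₀, F μ =
        ∑ p : (i : Fin q) → (c i).Edge → Choice M,
          F ((edgeAssignmentEquiv (Choice M) q c).symm (μ₀, p)) := by
    intro F
    rw [Finset.sum_filter, ← (edgeAssignmentEquiv (Choice M) q c).symm.sum_comp,
      Fintype.sum_prod_type, Finset.sum_eq_single μ₀]
    · exact Finset.sum_congr rfl fun p _ => if_pos rfl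
    · intro b _ hb
      exact Finset.sum_eq_zero fun p _ => if_neg hb
    · intro h
      exact (h (Finset.mem_univ _)).elim
  unfold treeContraction
  rw [hedge]
  simp only [hnode, hleaf]
  -- Expanding the product over the subtrees gives a sum over all edge assignments below the root
  -- node, and `ν` collects the root indices of the subtrees.
  have hprod : ∀ (ν : Fin q → Choice M) (f : (i : Fin q) → ((c i).Edge → Choice M) → ℂ),
      ∏ i, (∑ μ : (c i).Edge → Choice M with μ (c i).rootEdge = ν i, f i μ) =
        ∑ p : (i : Fin q) → (c i).Edge → Choice M,
          if (fun i => p i (c i).rootEdge) = ν then ∏ i, f i (p i) else 0 := by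
    intro ν f
    simp only [Finset.sum_filter]
    rw [Finset.prod_univ_sum, Fintype.piFinset_univ]
    refine Finset.sum_congr rfl fun p _ => ?_
    rw [Finset.prod_ite_zero]
    simp [funext_iff]
  have hprod' := fun ν => hprod ν fun i μ =>
    (∏ v : (c i).Node, tensorT θ (μ ((c i).inEdge v)) (fun j => μ ((c i).outEdge v j))) *
      ∏ j, G (finSigmaFinEquiv (n := fun i => (c i).numLeaves) ⟨i, j⟩) (μ ((c i).leafEdge j))
  simp only [hprod', Finset.mul_sum]
  rw [Finset.sum_comm]
  refine Finset.sum_congr rfl fun p _ => ?_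
  simp only [mul_ite, mul_zero, Finset.sum_ite_eq, Finset.mem_univ, if_true]
  rw [mul_assoc, ← Finset.prod_mul_distrib]
  congr 1
  refine Finset.prod_congr rfl fun i _ => ?_
  congr 1
  refine Finset.prod_congr rfl fun j _ => ?_
  rw [leafEdge_node]
  rfl

/-- A tree tensor network is the product of the vectors at its leaves, from left to right. -/
theorem treeContraction_eq_prod {M : ℕ} (θ : Fin M → Fin M → ℝ) (t : PlanarTree)
    (G : Fin t.numLeaves → Choice M → ℂ) (μ₀ : Choice M) :
    treeContraction θ t G μ₀ = (List.ofFn fun i => leftMul θ (G i)).prod μ₀ ∅ := by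
  induction t generalizing μ₀ with
  | leaf =>
    rw [treeContraction_leaf]
    have h : (List.ofFn fun i : Fin 1 => leftMul θ (G i)).prod μ₀ ∅ =
        leftMul θ (G (0 : Fin 1)) μ₀ ∅ := by
      simp
    exact (leftMul_apply_empty θ _ μ₀).symm.trans h.symm
  | node q c ih =>
    rw [treeContraction_node, sum_tensorT_mul_prod θ (fun i => treeContraction θ (c i)
          (fun j => G (finSigmaFinEquiv (n := fun i => (c i).numLeaves) ⟨i, j⟩)))]
    have h : ∀ i, leftMul θ (treeContraction θ (c i)
          (fun j => G (finSigmaFinEquiv (n := fun i => (c i).numLeaves) ⟨i, j⟩))) =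
        (List.ofFn fun j => leftMul θ
          (G (finSigmaFinEquiv (n := fun i => (c i).numLeaves) ⟨i, j⟩))).prod := by
      intro i
      have := leftMul_prod_col θ (List.ofFn fun j =>
          G (finSigmaFinEquiv (n := fun i => (c i).numLeaves) ⟨i, j⟩))
      rw [List.map_ofFn] at this
      refine Eq.trans ?_ this
      congr 1
      funext μ
      exact ih i _ μ
    simp only [h]
    rw [← prod_ofFn_finSigmaFinEquiv (fun i => (c i).numLeaves) (fun p => leftMul θ
      (G (finSigmaFinEquiv (n := fun i => (c i).numLeaves) p)))]
    simp only [Equiv.apply_symm_apply]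
    rfl

/-! ### One-particle vectors and their products -/

/-- The sites of `A` that are occupied in `σ`. -/
def particles {A : Finset ℕ} (σ : Occupation A) : Finset ℕ :=
  (Finset.univ.filter fun a => σ a = 1).map (Function.Embedding.subtype _)

/-- The vector of one particle at the site `x`: its component at the choice `{s}` is the plane
wave `exp (i k_s x)`, and its components at all other choices vanish. -/
noncomputable def siteVector {M : ℕ} (k : Fin M → ℝ) (x : ℕ) (a : Choice M) : ℂ :=
  ∑ s, if a = {s} then Complex.exp (Complex.I * ((k s : ℂ) * (x : ℂ))) else 0

theorem sum_tensorT_mul_prod_siteVector {M n : ℕ} (k : Fin M → ℝ) (θ : Fin M → Fin M → ℝ)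
    (y : Fin n → ℕ) (c : Choice M) :
    ∑ ν : Fin n → Choice M, tensorT θ c ν * ∏ j, siteVector k (y j) (ν j) =
      ∑ g : Fin n → Fin M, tensorT θ c (fun j => {g j}) *
        ∏ j, Complex.exp (Complex.I * ((k (g j) : ℂ) * (y j : ℂ))) := by
  have h : ∀ ν : Fin n → Choice M, ∏ j, siteVector k (y j) (ν j) =
      ∑ g : Fin n → Fin M, if ν = (fun j => {g j}) then
        ∏ j, Complex.exp (Complex.I * ((k (g j) : ℂ) * (y j : ℂ))) else 0 := by
    intro ν
    simp only [siteVector]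
    rw [Finset.prod_univ_sum, Fintype.piFinset_univ]
    refine Finset.sum_congr rfl fun g _ => ?_
    rw [Finset.prod_ite_zero]
    simp [funext_iff]
  simp only [h, Finset.mul_sum]
  rw [Finset.sum_comm]
  simp

theorem tensorT_singletons {M n : ℕ} (θ : Fin M → Fin M → ℝ) (c : Choice M)
    (g : Fin n → Fin M) :
    tensorT θ c (fun j => {g j}) =
      if Finset.univ.val.map g = c.val then
        ∏ i, ∏ j ∈ Finset.Ioi i, scatteringPhase θ (g i) (g j) else 0 := by
  have h : choiceUnion (fun j => ({g j} : Choice M)) = Finset.univ.val.map g := by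
    rw [← Multiset.sum_map_singleton (Finset.univ.val.map g), Multiset.map_map]
    rfl
  simp [tensorT, h, multiAmplitude, pairAmplitude]

/-- The product of `n ≠ m` one-particle vectors has no component at choices of size `m`. -/
theorem prod_siteVector_of_ne {M m n : ℕ} (k : Fin M → ℝ) (θ : Fin M → Fin M → ℝ)
    (y : Fin n → ℕ) (c : Choice M) (hc : c.card = m) (hne : n ≠ m) :
    (List.ofFn fun j => leftMul θ (siteVector k (y j))).prod c ∅ = 0 := by
  rw [← sum_tensorT_mul_prod θ (fun j => siteVector k (y j)), sum_tensorT_mul_prod_siteVector]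
  refine Finset.sum_eq_zero fun g _ => ?_
  rw [tensorT_singletons, if_neg, zero_mul]
  intro h
  have := congrArg Multiset.card h
  simp [hc] at this
  exact hne this

/-- The component of a product of `m` one-particle vectors at a choice of size `m` is the Bethe
sum over the permutations of the entries of the choice. -/
theorem prod_siteVector {M m : ℕ} (k : Fin M → ℝ) (θ : Fin M → Fin M → ℝ)
    (y : Fin m → ℕ) (e : Fin m ↪o Fin M) :
    (List.ofFn fun j => leftMul θ (siteVector k (y j))).prod (Finset.univ.map e.toEmbedding) ∅ =
      ∑ P : Equiv.Perm (Fin m), permAmplitude (fun j₂ j₁ => θ (e j₂) (e j₁)) P *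
        Complex.exp (Complex.I * ∑ j, (k (e (P j)) : ℂ) * (y j : ℂ)) := by
  rw [← sum_tensorT_mul_prod θ (fun j => siteVector k (y j)), sum_tensorT_mul_prod_siteVector]
  symm
  refine Fintype.sum_of_injective (fun (P : Equiv.Perm (Fin m)) j => e (P j)) ?_ _ _ ?_ ?_
  · intro P Q h
    ext j
    exact congrArg Fin.val (e.injective (congrFun h j))
  -- A tuple `g` contributes only if its entries are those of the choice, each of them once, and
  -- then it is a rearrangement of `e`.
  · intro g hg
    rw [tensorT_singletons, if_neg, zero_mul]
    intro h
    refine hg ?_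
    rw [Finset.map_val] at h
    have hP : ∀ j, ∃ p, e p = g j := by
      intro j
      have : g j ∈ Finset.univ.val.map g := Multiset.mem_map_of_mem g (Finset.mem_univ j)
      rw [h] at this
      obtain ⟨p, -, hp⟩ := Multiset.mem_map.1 this
      exact ⟨p, hp⟩
    choose P hP using hP
    have hg' : Function.Injective g := by
      have : (Finset.univ.val.map g).Nodup := by
        rw [h]
        exact Finset.univ.nodup.map e.injective
      intro a b hab
      exact Multiset.inj_on_of_nodup_map this a (Finset.mem_univ a) b (Finset.mem_univ b) hab
    have hPi : Function.Injective P := fun a b hab => hg' (by rw [← hP, ← hP, hab])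
    exact ⟨Equiv.ofBijective P (Finite.injective_iff_bijective.1 hPi), funext hP⟩
  · intro P
    rw [tensorT_singletons, if_pos]
    · rw [← Complex.exp_sum, Finset.mul_sum]
      simp [permAmplitude, scatteringPhase]
    · rw [Finset.map_val]
      have h : Finset.univ.val.map P = Finset.univ.val := by
        have := congrArg Finset.val (Finset.map_univ_equiv P)
        rwa [Finset.map_val] at this
      conv_rhs => rw [← h]
      rw [Multiset.map_map]
      rfl

/-! ### Bethe amplitudes as ordered products over occupied sites -/

theorem list_eq_sort {l : List ℕ} {s : Finset ℕ} (hl : l.Pairwise (· < ·))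
    (hs : ∀ x, x ∈ l ↔ x ∈ s) : l = s.sort (· ≤ ·) := by
  refine List.Perm.eq_of_pairwise (le := (· ≤ ·)) (fun a b _ _ => le_antisymm) (hl.imp le_of_lt)
    (Finset.pairwise_sort _ _) ?_
  rw [List.perm_ext_iff_of_nodup (hl.imp ne_of_lt) (Finset.sort_nodup _ _)]
  simp [hs]

theorem occupationOf_eq_iff {A : Finset ℕ} {m : ℕ} (x : Fin m → A) (σ : Occupation A) :
    occupationOf x = σ ↔ ∀ a, (∃ j, x j = a) ↔ σ a = 1 := by
  rw [funext_iff]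
  refine forall_congr' fun a => ?_
  rw [occupationOf]
  split_ifs with h
  · exact ⟨fun h' => ⟨fun _ => h'.symm, fun _ => h⟩, fun h' => (h'.1 h).symm⟩
  · have : σ a = 0 ∨ σ a = 1 := by
      generalize σ a = b
      fin_cases b <;> simp
    rcases this with h' | h' <;> simp [h, h']

/-- A Bethe amplitude is the ordered product of the one-particle vectors of the occupied sites,
read off at the choice of the quasi-momenta. -/
theorem betheWavefunction_eq_prod {M m : ℕ} (k : Fin M → ℝ) (θ : Fin M → Fin M → ℝ)
    (A : Finset ℕ) (e : Fin m ↪o Fin M) (σ : Occupation A) :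
    betheWavefunction A (fun j => k (e j)) (fun j₂ j₁ => θ (e j₂) (e j₁)) σ =
      (((particles σ).sort (· ≤ ·)).map fun x => leftMul θ (siteVector k x)).prod
        (Finset.univ.map e.toEmbedding) ∅ := by
  classical
  set Y : Finset A := Finset.univ.filter fun a => σ a = 1 with hY
  have hsort : ∀ n (h : Y.card = n), (particles σ).sort (· ≤ ·) =
      List.ofFn fun j => ((Y.orderEmbOfFin h j : A) : ℕ) := by
    intro n h
    refine (list_eq_sort ?_ ?_).symm
    · rw [List.pairwise_ofFn]
      exact fun i j hij => (Y.orderEmbOfFin h).strictMono hij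
    · intro x
      rw [List.mem_ofFn, particles, ← hY, Finset.mem_map]
      constructor
      · rintro ⟨j, rfl⟩
        exact ⟨_, Finset.orderEmbOfFin_mem Y h j, rfl⟩
      · rintro ⟨a, ha, rfl⟩
        have : a ∈ Set.range (Y.orderEmbOfFin h) := by
          rw [Finset.range_orderEmbOfFin]
          exact ha
        obtain ⟨j, rfl⟩ := this
        exact ⟨j, rfl⟩
  have hmem : ∀ x : Fin m → A, occupationOf x = σ → ∀ a, a ∈ Y ↔ ∃ j, x j = a := by
    intro x hx a
    rw [hY, Finset.mem_filter, (occupationOf_eq_iff x σ).1 hx a]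
    simp
  -- At most one position vector has the bit string `σ`, and there is one exactly if `σ` has `m`
  -- particles.
  rw [betheWavefunction, Finset.sum_apply]
  by_cases h : Y.card = m
  · rw [hsort m h, List.map_ofFn]
    refine Eq.trans ?_ (prod_siteVector k θ _ e).symm
    rw [Finset.sum_eq_single (⇑(Y.orderEmbOfFin h))]
    · have : occupationOf (Y.orderEmbOfFin h) = σ := by
        rw [occupationOf_eq_iff]
        intro a
        have := Set.ext_iff.1 (Finset.range_orderEmbOfFin Y h) a
        rw [Set.mem_range] at this
        rw [this]
        simp [hY]
      rw [this, Pi.smul_apply, ket, Pi.single_eq_same, smul_eq_mul, mul_one]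
    · intro x hx hne
      have hne' : occupationOf x ≠ σ := by
        intro hxσ
        refine hne (Finset.orderEmbOfFin_unique h (fun j => ?_) (Finset.mem_filter.1 hx).2)
        exact (hmem x hxσ _).2 ⟨j, rfl⟩
      rw [Pi.smul_apply, ket, Pi.single_eq_of_ne hne'.symm, smul_zero]
    · intro hx
      exact (hx (Finset.mem_filter.2 ⟨Finset.mem_univ _, (Y.orderEmbOfFin h).strictMono⟩)).elim
  · rw [hsort _ rfl, List.map_ofFn]
    refine Eq.trans ?_ (prod_siteVector_of_ne k θ _ _ (by simp) h).symm
    refine Finset.sum_eq_zero fun x hx => ?_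
    have hne' : occupationOf x ≠ σ := by
      intro hxσ
      have : Y = Finset.univ.image x := by
        ext a
        simp [hmem x hxσ a]
      refine h ?_
      rw [this, Finset.card_image_of_injective _ (Finset.mem_filter.1 hx).2.injective]
      simp
    rw [Pi.smul_apply, ket, Pi.single_eq_of_ne hne'.symm, smul_zero]

/-! ### Left-right partitions and networks -/

/-- The matrix product state tensor of a part is the ordered product of the matrices of its
occupied sites. -/
theorem tensorR_eq_prod {M : ℕ} (k : Fin M → ℝ) (θ : Fin M → Fin M → ℝ) (A : Finset ℕ)
    (σ : Occupation A) :
    tensorR k θ A σ =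
      (((particles σ).sort (· ≤ ·)).map fun x => leftMul θ (siteVector k x)).prod := by
  have h := leftMul_prod_col θ (((particles σ).sort (· ≤ ·)).map fun x => siteVector k x)
  rw [List.map_map] at h
  refine Eq.trans ?_ h
  change leftMul θ (fun a => tensorS k θ A a σ) = _
  congr 1
  funext c
  refine (betheWavefunction_eq_prod k θ A (c.orderEmbOfFin rfl) σ).trans ?_
  rw [show Finset.univ.map (c.orderEmbOfFin rfl).toEmbedding = c from
    Finset.map_orderEmbOfFin_univ c rfl]
  rfl

/-- The occupied sites of the lattice, in increasing order, are those of the parts of a left-right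
partition, one part after the other. -/
theorem sort_particles_restrict {N L : ℕ} (A : LeftRightPartition N L)
    (σ : Occupation (Finset.Icc 1 N)) :
    (particles σ).sort (· ≤ ·) =
      (List.ofFn fun i => (particles (A.restrict σ i)).sort (· ≤ ·)).flatten := by
  have hpart : ∀ i x, x ∈ particles (A.restrict σ i) → x ∈ A.part i := by
    intro i x hx
    obtain ⟨a, -, rfl⟩ := Finset.mem_map.1 hx
    exact a.2
  refine (list_eq_sort ?_ ?_).symm
  · rw [List.pairwise_flatten, List.pairwise_ofFn]
    constructor
    · intro l hl
      obtain ⟨i, rfl⟩ := (List.mem_ofFn' _ _).1 hl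
      exact (Finset.sortedLT_sort _).pairwise
    · intro i j hij x hx y hy
      exact A.ordered i j hij x (hpart i x ((Finset.mem_sort _).1 hx)) y
        (hpart j y ((Finset.mem_sort _).1 hy))
  · intro x
    simp only [List.mem_flatten, List.mem_ofFn, exists_exists_eq_and, Finset.mem_sort]
    constructor
    · rintro ⟨i, hi⟩
      obtain ⟨a, ha, rfl⟩ := Finset.mem_map.1 hi
      exact Finset.mem_map.2 ⟨_, Finset.mem_filter.2 ⟨Finset.mem_univ _,
        (Finset.mem_filter.1 ha).2⟩, rfl⟩
    · intro hx
      obtain ⟨a, ha, rfl⟩ := Finset.mem_map.1 hx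
      obtain ⟨i, -, hi⟩ := Finset.mem_biUnion.1 (A.cover.symm.subset a.2)
      exact ⟨i, Finset.mem_map.2 ⟨⟨a.1, hi⟩, Finset.mem_filter.2 ⟨Finset.mem_univ _,
        (Finset.mem_filter.1 ha).2⟩, rfl⟩⟩

theorem betheWavefunction_eq_prod_tensorR {M N L : ℕ} (k : Fin M → ℝ) (θ : Fin M → Fin M → ℝ)
    (A : LeftRightPartition N L) (σ : Occupation (Finset.Icc 1 N)) :
    betheWavefunction (Finset.Icc 1 N) k θ σ =
      (List.ofFn fun i => tensorR k θ (A.part i) (A.restrict σ i)).prod Finset.univ ∅ := by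
  have h := betheWavefunction_eq_prod k θ (Finset.Icc 1 N) (RelEmbedding.refl _) σ
  rw [show Finset.univ.map (RelEmbedding.refl ((· ≤ ·) : Fin M → Fin M → Prop)).toEmbedding =
    Finset.univ from Finset.map_refl, sort_particles_restrict A, List.map_flatten,
    List.prod_flatten, List.map_ofFn, List.map_ofFn] at h
  simp only [tensorR_eq_prod]
  exact h

theorem contraction_betheTTN_eq_prod_tensorR {M N : ℕ} (k : Fin M → ℝ)
    (θ : Fin M → Fin M → ℝ) (t : PlanarTree) (A : LeftRightPartition N t.numLeaves)
    (σ : ∀ i, Occupation (A.part i)) :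
    (betheTTN k θ t A).contraction σ =
      (List.ofFn fun i => tensorR k θ (A.part i) (σ i)).prod Finset.univ ∅ := by
  rw [contraction_betheTTN, treeContraction_eq_prod]
  rfl

theorem bondDim_betheTTN_le {M N : ℕ} (k : Fin M → ℝ) (θ : Fin M → Fin M → ℝ)
    (t : PlanarTree) (A : LeftRightPartition N t.numLeaves) :
    (betheTTN k θ t A).bondDim ≤ 2 ^ M := by
  refine Finset.sup_le fun e _ => ?_
  have h : Fintype.card ((betheTTN k θ t A).Index e) = Fintype.card (Choice M) :=
    Fintype.card_congr (Equiv.refl _)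
  rw [h]
  simp

/-! ### Chains and regular binary trees -/

namespace PlanarTree

theorem numNodes_chain (n : ℕ) : (chain n).numNodes = n + 1 := by
  induction n with
  | zero => simp [chain, numNodes]
  | succ n ih =>
    simp [chain, numNodes, Fin.sum_univ_two, ih]
    omega

theorem numLeaves_chain (n : ℕ) : (chain n).numLeaves = n + 1 := by
  induction n with
  | zero => simp [chain, numLeaves]
  | succ n ih =>
    simp [chain, numLeaves, Fin.sum_univ_two, ih]
    omega

theorem numLeaves_binary (Z : ℕ) : (binary Z).numLeaves = 2 ^ Z := by
  induction Z with
  | zero => rfl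
  | succ Z ih => simp [binary, numLeaves, ih, pow_succ, mul_comm]

theorem numNodes_binary_add_one (Z : ℕ) : (binary Z).numNodes + 1 = 2 ^ Z := by
  induction Z with
  | zero => rfl
  | succ Z ih =>
    simp only [binary, numNodes, Finset.sum_const, Finset.card_univ, Fintype.card_fin,
      smul_eq_mul, pow_succ]
    omega

end PlanarTree

theorem mainTheorem8 {M N : ℕ} (k : Fin M → ℝ) (θ : Fin M → Fin M → ℝ) :
    -- every planar tree
    (∀ (t : PlanarTree) (A : LeftRightPartition N t.numLeaves),
      (∀ σ : Occupation (Finset.Icc 1 N),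
        betheWavefunction (Finset.Icc 1 N) k θ σ =
          (betheTTN k θ t A).contraction (A.restrict σ)) ∧
      (betheTTN k θ t A).numNodeTensors = t.numNodes ∧
      (betheTTN k θ t A).numLeafTensors = t.numLeaves ∧
      (betheTTN k θ t A).bondDim ≤ 2 ^ M) ∧
    -- matrix product state: a product of one matrix for each part
    (∀ (L : ℕ) (A : LeftRightPartition N L) (σ : Occupation (Finset.Icc 1 N)),
      betheWavefunction (Finset.Icc 1 N) k θ σ =
        (List.ofFn fun i => tensorR k θ (A.part i) (A.restrict σ i)).prod Finset.univ ∅) ∧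
    Fintype.card (Choice M) ≤ 2 ^ M ∧
    -- it is the network of the chain with as many nodes as leaves
    (∀ n : ℕ, (PlanarTree.chain n).numNodes = n + 1 ∧ (PlanarTree.chain n).numLeaves = n + 1 ∧
      ∀ (A : LeftRightPartition N (PlanarTree.chain n).numLeaves)
        (σ : Occupation (Finset.Icc 1 N)),
        (betheTTN k θ (PlanarTree.chain n) A).contraction (A.restrict σ) =
          (List.ofFn fun i => tensorR k θ (A.part i) (A.restrict σ i)).prod Finset.univ ∅) ∧
    -- regular binary tree with `L = 2 ^ Z` leaves and `L - 1` nodes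
    (∀ Z : ℕ, (PlanarTree.binary Z).numLeaves = 2 ^ Z ∧
      ∀ A : LeftRightPartition N (PlanarTree.binary Z).numLeaves,
        (∀ σ : Occupation (Finset.Icc 1 N),
          betheWavefunction (Finset.Icc 1 N) k θ σ =
            (betheTTN k θ (PlanarTree.binary Z) A).contraction (A.restrict σ)) ∧
        (betheTTN k θ (PlanarTree.binary Z) A).numNodeTensors + 1 = 2 ^ Z ∧
        (betheTTN k θ (PlanarTree.binary Z) A).numLeafTensors = 2 ^ Z ∧
        (betheTTN k θ (PlanarTree.binary Z) A).bondDim ≤ 2 ^ M) := by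
  have htree : ∀ (t : PlanarTree) (A : LeftRightPartition N t.numLeaves)
      (σ : Occupation (Finset.Icc 1 N)), betheWavefunction (Finset.Icc 1 N) k θ σ =
        (betheTTN k θ t A).contraction (A.restrict σ) := fun t A σ =>
    (betheWavefunction_eq_prod_tensorR k θ A σ).trans
      (contraction_betheTTN_eq_prod_tensorR k θ t A _).symm
  refine ⟨fun t A => ⟨htree t A, t.card_node, Fintype.card_fin _, bondDim_betheTTN_le k θ t A⟩,
    fun L A σ => betheWavefunction_eq_prod_tensorR k θ A σ, by simp, fun n => ⟨?_, ?_, ?_⟩,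
    fun Z => ⟨PlanarTree.numLeaves_binary Z, fun A => ⟨htree _ A, ?_, ?_, ?_⟩⟩⟩
  · exact PlanarTree.numNodes_chain n
  · exact PlanarTree.numLeaves_chain n
  · exact fun A σ => contraction_betheTTN_eq_prod_tensorR k θ _ A _
  · exact (congrArg (· + 1) (PlanarTree.card_node _)).trans (PlanarTree.numNodes_binary_add_one Z)
  · exact (Fintype.card_fin _).trans (PlanarTree.numLeaves_binary Z)
  · exact bondDim_betheTTN_le k θ _ A
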